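/- Let $N \ge 2$, let $\Omega \subset \mathbb{C}^N$ be a bounded open set, and let $x_0 \in \Omega$. For a compact set $X \subset \mathbb{C}^N$ let $\|\cdot\|_X$ be the supremum norm on $X$, let $\widehat{X} = \{ z \in \mathbb{C}^N : |p(z)| \le \|p\|_X \text{ for all polynomials } p \}$ be its polynomial hull, and let $P(X)$ be the closure in $(C(X), \|\cdot\|_X)$ of the polynomials in the complex coordinate functions $z_1, \dots, z_N$. Each $z \in \widehat{X}$ defines a point of the maximal ideal space of $P(X)$, namely the unique character $\varphi_z$ of $P(X)$ with $\varphi_z(p) = p(z)$ for all polynomials $p$. The point $z$ is called a one-point Gleason part for $P(X)$ if $\varphi_z$ is the only character $\psi$ of $P(X)$ with $\|\varphi_z - \psi\| < 2$ in the norm of the dual space $P(X)^*$. Then there exists a compact set $X \subset \partial\Omega$ such that $x_0 \in \widehat{X} \setminus X$, the point $x_0$ is a one-point Gleason part for $P(X)$, and the invertible elements of $P(X)$ are dense in $P(X)$. -/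

import Mathlib

open TopologicalSpace WeakDual

noncomputable section

/-! The space `ℂᴺ` is `Fin N → ℂ`; only its topology and its bounded sets matter here, and these are
the same as for the Euclidean norm. Polynomials in the complex coordinate functions are elements of
`MvPolynomial (Fin N) ℂ`. -/

/-- The restriction of polynomials to a compact set `X ⊂ ℂᴺ`, as elements of `C(X)`. -/
def polyOn {N : ℕ} (X : Compacts (Fin N → ℂ)) : MvPolynomial (Fin N) ℂ →ₐ[ℂ] C(X, ℂ) where
  toFun p := ⟨fun x => MvPolynomial.eval (x : Fin N → ℂ) p,
    (MvPolynomial.continuous_eval p).comp continuous_subtype_val⟩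
  map_one' := by ext x; simp
  map_mul' p q := by ext x; simp
  map_zero' := by ext x; simp
  map_add' p q := by ext x; simp
  commutes' c := by ext x; simp

/-- The polynomial hull of a compact set `X ⊂ ℂᴺ`: all `z` with `|p(z)| ≤ ‖p‖_X` for every
polynomial `p`, where `‖p‖_X` is the supremum norm of `p` on `X`. -/
def polynomialHull {N : ℕ} (X : Compacts (Fin N → ℂ)) : Set (Fin N → ℂ) :=
  {z | ∀ p : MvPolynomial (Fin N) ℂ, ‖MvPolynomial.eval z p‖ ≤ ‖polyOn X p‖}

/-- The uniform algebra `P(X)`: the uniform closure in `C(X)` of the polynomials. -/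
def polyAlg {N : ℕ} (X : Compacts (Fin N → ℂ)) : Subalgebra ℂ C(X, ℂ) :=
  (polyOn X).range.topologicalClosure

/-- A polynomial, as an element of `P(X)`. -/
def polyAlg.ofPoly {N : ℕ} (X : Compacts (Fin N → ℂ)) :
    MvPolynomial (Fin N) ℂ →ₐ[ℂ] polyAlg X :=
  (polyOn X).codRestrict (polyAlg X)
    (fun p => (polyOn X).range.le_topologicalClosure ⟨p, rfl⟩)

theorem polyAlg.denseRange_ofPoly {N : ℕ} (X : Compacts (Fin N → ℂ)) :
    DenseRange (polyAlg.ofPoly X).toLinearMap := by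
  intro f
  rw [closure_subtype]
  have h : (f : C(X, ℂ)) ∈ closure ((polyOn X).range : Set C(X, ℂ)) := f.2
  convert h using 2
  ext g
  constructor
  · rintro ⟨_, ⟨p, rfl⟩, rfl⟩
    exact ⟨p, rfl⟩
  · rintro ⟨p, rfl⟩
    exact ⟨_, ⟨p, rfl⟩, rfl⟩

/-- Evaluation at a point `z` of the polynomial hull, extended from the polynomials to `P(X)` by
continuity, as a bounded linear functional. -/
def polyAlg.evalCLM {N : ℕ} (X : Compacts (Fin N → ℂ)) (z : Fin N → ℂ) : polyAlg X →L[ℂ] ℂ :=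
  (MvPolynomial.aeval z : MvPolynomial (Fin N) ℂ →ₐ[ℂ] ℂ).toLinearMap.extendOfNorm
    (polyAlg.ofPoly X).toLinearMap

theorem polyAlg.evalCLM_ofPoly {N : ℕ} (X : Compacts (Fin N → ℂ)) {z : Fin N → ℂ}
    (hz : z ∈ polynomialHull X) (p : MvPolynomial (Fin N) ℂ) :
    polyAlg.evalCLM X z (polyAlg.ofPoly X p) = MvPolynomial.eval z p :=
  LinearMap.extendOfNorm_eq (polyAlg.denseRange_ofPoly X)
    ⟨1, fun q => by rw [one_mul]; exact hz q⟩ p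

theorem polyAlg.evalCLM_one {N : ℕ} (X : Compacts (Fin N → ℂ)) {z : Fin N → ℂ}
    (hz : z ∈ polynomialHull X) : polyAlg.evalCLM X z 1 = 1 := by
  simpa using polyAlg.evalCLM_ofPoly X hz 1

theorem polyAlg.evalCLM_mul {N : ℕ} (X : Compacts (Fin N → ℂ)) {z : Fin N → ℂ}
    (hz : z ∈ polynomialHull X) (f g : polyAlg X) :
    polyAlg.evalCLM X z (f * g) = polyAlg.evalCLM X z f * polyAlg.evalCLM X z g := by
  refine (polyAlg.denseRange_ofPoly X).induction_on₂
    (p := fun f g => polyAlg.evalCLM X z (f * g) = polyAlg.evalCLM X z f * polyAlg.evalCLM X z g)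
    (isClosed_eq (by fun_prop) (by fun_prop)) (fun p q => ?_) f g
  have h := polyAlg.evalCLM_ofPoly X hz (p * q)
  rw [map_mul (polyAlg.ofPoly X), map_mul (MvPolynomial.eval z)] at h
  simp only [AlgHom.toLinearMap_apply, polyAlg.evalCLM_ofPoly X hz]
  exact h

/-- The point of the maximal ideal space of `P(X)` given by a point `z` of the polynomial hull
of `X`: the unique character of `P(X)` whose value at each polynomial `p` is `p(z)`. -/
def polyAlg.evalAt {N : ℕ} (X : Compacts (Fin N → ℂ)) (z : Fin N → ℂ)
    (hz : z ∈ polynomialHull X) : characterSpace ℂ (polyAlg X) :=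
  ⟨StrongDual.toWeakDual (polyAlg.evalCLM X z), by
    rw [CharacterSpace.eq_set_map_one_map_mul]
    exact ⟨polyAlg.evalCLM_one X hz, polyAlg.evalCLM_mul X hz⟩⟩

theorem polyAlg.evalAt_ofPoly {N : ℕ} (X : Compacts (Fin N → ℂ)) {z : Fin N → ℂ}
    (hz : z ∈ polynomialHull X) (p : MvPolynomial (Fin N) ℂ) :
    polyAlg.evalAt X z hz (polyAlg.ofPoly X p) = MvPolynomial.eval z p :=
  polyAlg.evalCLM_ofPoly X hz p

/-- The Gleason part of a point `φ` of the maximal ideal space of a uniform algebra `A`: all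
characters `ψ` with `‖φ - ψ‖ < 2` in the norm of the dual space of `A`. -/
def gleasonPart {A : Type*} [NormedRing A] [NormedAlgebra ℂ A] (φ : characterSpace ℂ A) :
    Set (characterSpace ℂ A) :=
  {ψ | ‖CharacterSpace.toCLM φ - CharacterSpace.toCLM ψ‖ < 2}

/-- The point `φ` of the maximal ideal space is a one-point Gleason part. -/
def IsOnePointGleasonPart {A : Type*} [NormedRing A] [NormedAlgebra ℂ A]
    (φ : characterSpace ℂ A) : Prop :=
  gleasonPart φ = {φ}

/-- The algebra `A` has dense invertibles: its invertible elements are dense in `A`. -/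
def HasDenseInvertibles (A : Type*) [NormedRing A] : Prop :=
  Dense {a : A | IsUnit a}

end

/-! The set `X` is built so that exponentials are dense in `P(X)`; this gives both conclusions about
the algebra, and a maximum principle keeps `x₀` in the hull.

Take polynomials dense on `closure Ω` and nonzero at `x₀`, and let `Pₙ` be their multiples with
`Pₙ(x₀) = 1`. Put `F₀ = 0` and `Fₙ₊₁ = Pₙ exp(Mₙ Fₙ) - 1`, and let `X` be the intersection of the
sets `Tₙ = {Re Fₙ ≥ -1/2}` in the boundary. If `Mₙ` is large, then `Re Fₙ < -1/2` makes `Pₙ exp(Mₙ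
Fₙ)` small and forces `Re Fₙ₊₁ < -1/2`; so the `Tₙ` decrease (`neg_half_le_re_iteratedExp_of_succ`).
On `X` the function `1 + Fₙ₊₁ = Pₙ exp(Mₙ Fₙ)` has real part at least `1/2`, so it has a logarithm
in `P(X)`, and so has `Pₙ` (`exists_mem_polyAlg_exp_eq`).

Each `Fₙ` is entire with `Fₙ(x₀) = 0`. As `N ≥ 2`, its zero set through `x₀` reaches the boundary,
and polynomials obey the maximum principle there (`exists_mem_frontier_zero_norm_le_pi`). These
boundary zeros lie in `Tₙ`, and compactness passes the estimate on to `X`.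

Exponentials are invertible and have roots of every order in the algebra. High roots push a nonzero
value of one character towards the unit circle while the value of another stays in a smaller disc; a
Möbius map then brings the dual distance of the two arbitrarily close to 2
(`isOnePointGleasonPart_of_dense_exp`). -/

/-! ### Zeros of entire functions and residues -/

open Metric in
theorem finite_zeros_of_isCompact {F : ℂ → ℂ} (hF : Differentiable ℂ F) (hne : ∃ z, F z ≠ 0)
    {K : Set ℂ} (hK : IsCompact K) : {z ∈ K | F z = 0}.Finite := by
  by_contra hinf
  obtain ⟨z, hz, hacc⟩ := Set.Infinite.exists_accPt_of_subset_isCompact hinf hK (fun _ h => h.1)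
  obtain ⟨y, hy⟩ := hne
  have hfr : ∃ᶠ w in nhdsWithin z {z}ᶜ, F w = (0 : ℂ → ℂ) w := by
    rw [accPt_iff_frequently_nhdsNE] at hacc
    exact hacc.mono fun w hw => hw.2
  exact hy (congrFun (AnalyticOnNhd.eq_of_frequently_eq
    (fun w _ => hF.analyticAt w) (fun w _ => analyticAt_const) hfr) y)

theorem exists_eq_pow_mul_of_ne_zero {F : ℂ → ℂ} (hF : Differentiable ℂ F) (hne : ∃ z, F z ≠ 0)
    (c : ℂ) : ∃ (m : ℕ) (g : ℂ → ℂ), Differentiable ℂ g ∧ g c ≠ 0 ∧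
      ∀ z, F z = (z - c) ^ m * g z := by
  obtain ⟨p, hp⟩ := hF.analyticAt c
  have hp0 : p ≠ 0 := by
    rintro rfl
    obtain ⟨y, hy⟩ := hne
    refine hy (congrFun (AnalyticOnNhd.eq_of_eventuallyEq (z₀ := c) (g := 0)
      (fun w _ => hF.analyticAt w) (fun w _ => analyticAt_const) ?_) y)
    exact hp.eventually_eq_zero
  refine ⟨p.order, (Function.swap dslope c)^[p.order] F, ?_, hp.iterate_dslope_fslope_ne_zero hp0,
    fun z => ?_⟩
  · have : ∀ n : ℕ, Differentiable ℂ ((Function.swap dslope c)^[n] F) := by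
      intro n
      induction n with
      | zero => simpa using hF
      | succ n ih =>
        rw [Function.iterate_succ_apply', ← differentiableOn_univ]
        exact (Complex.differentiableOn_dslope Filter.univ_mem).2 ih.differentiableOn
    exact this _
  · simpa using hp.eq_pow_order_mul_iterate_dslope z

theorem exists_eq_prod_mul_of_isCompact {K : Set ℂ} (hK : IsCompact K) {F : ℂ → ℂ}
    (hF : Differentiable ℂ F) (hne : ∃ z, F z ≠ 0) :
    ∃ (s : Multiset ℂ) (g : ℂ → ℂ), Differentiable ℂ g ∧ (∀ z ∈ s, z ∈ K) ∧
      (∀ z ∈ K, g z ≠ 0) ∧ ∀ z, F z = (s.map (z - ·)).prod * g z := by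
  have hfin := finite_zeros_of_isCompact hF hne hK
  induction hn : hfin.toFinset.card using Nat.strong_induction_on generalizing F with
  | _ n ih =>
    by_cases hz : ∃ c ∈ K, F c = 0
    · obtain ⟨c, hcK, hc⟩ := hz
      obtain ⟨m, g, hg, hgc, hfg⟩ := exists_eq_pow_mul_of_ne_zero hF hne c
      have hgfin := finite_zeros_of_isCompact hg ⟨c, hgc⟩ hK
      obtain ⟨s, h, hh, hs, hh0, hgh⟩ := ih hgfin.toFinset.card (by
        rw [← hn]
        apply Finset.card_lt_card
        rw [Finset.ssubset_iff_of_subset]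
        · exact ⟨c, by simp [hcK, hc], by simp [hgc]⟩
        · intro z
          simp only [Set.Finite.mem_toFinset, Set.mem_ofPred_eq]
          rintro ⟨h1, h2⟩
          exact ⟨h1, by rw [hfg, h2, mul_zero]⟩) hg ⟨c, hgc⟩ hgfin rfl
      refine ⟨Multiset.replicate m c + s, h, hh, ?_, hh0, fun z => ?_⟩
      · intro z hz
        rcases Multiset.mem_add.1 hz with hz | hz
        · rwa [Multiset.eq_of_mem_replicate hz]
        · exact hs z hz
      · rw [hfg, hgh]
        simp [mul_assoc]
    · push Not at hz
      exact ⟨0, F, hF, by simp, hz, by simp⟩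

open Metric in
/-- The residue theorem for `Q F' / F` on a disc, where `F` and `Q` are entire. -/
theorem circleIntegral_mul_logDeriv {F : ℂ → ℂ} (hF : Differentiable ℂ F) {c : ℂ} {r : ℝ}
    (hr : 0 < r) (h0 : ∀ z ∈ sphere c r, F z ≠ 0) :
    ∃ s : Multiset ℂ, (∀ z, z ∈ s ↔ z ∈ ball c r ∧ F z = 0) ∧
      ∀ Q : ℂ → ℂ, Differentiable ℂ Q →
        (∮ z in C(c, r), Q z * (deriv F z / F z)) =
          2 * Real.pi * Complex.I * (s.map Q).sum := by
  have hne : ∃ z, F z ≠ 0 := by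
    obtain ⟨z, hz⟩ := (NormedSpace.sphere_nonempty (x := c)).2 hr.le
    exact ⟨z, h0 z hz⟩
  obtain ⟨s, g, hg, hs, hg0, hfg⟩ :=
    exists_eq_prod_mul_of_isCompact (isCompact_closedBall c r) hF hne
  have hsF : ∀ z ∈ s, F z = 0 := by
    intro z hz
    rw [hfg, Multiset.prod_eq_zero, zero_mul]
    exact Multiset.mem_map.2 ⟨z, hz, sub_self z⟩
  have hsb : ∀ z ∈ s, z ∈ ball c r := by
    intro z hz
    have h1 := hs z hz
    rw [← ball_union_sphere] at h1
    exact h1.resolve_right fun h => h0 z h (hsF z hz)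
  refine ⟨s, fun z => ⟨fun h => ⟨hsb z h, hsF z h⟩, fun ⟨hz, hz0⟩ => ?_⟩, fun Q hQ => ?_⟩
  · rw [hfg, mul_eq_zero, or_iff_left (hg0 z (ball_subset_closedBall hz)),
      Multiset.prod_eq_zero_iff, Multiset.mem_map] at hz0
    obtain ⟨w, hw, hzw⟩ := hz0
    rwa [sub_eq_zero.1 hzw]
  · clear hs hsF h0 hne
    -- Splitting off a root `a` adds `Q z / (z - a)` to the integrand, which Cauchy's formula
    -- evaluates; the cofactor without zeros contributes nothing.
    induction s using Multiset.induction_on generalizing F with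
    | empty =>
      have hFg : F = g := by ext z; simpa using hfg z
      subst hFg
      simp only [Multiset.map_zero, Multiset.sum_zero, mul_zero]
      refine Complex.circleIntegral_eq_zero_of_differentiable_on_off_countable hr.le
        Set.countable_empty ?_ ?_
      · have := hg.contDiff (n := 1)
        exact hQ.continuous.continuousOn.mul
          (((this.continuous_deriv le_rfl).continuousOn).div hg.continuous.continuousOn hg0)
      · intro z hz
        exact (hQ z).mul (((hg.analyticAt z).deriv.differentiableAt).div (hg z)
          (hg0 z (ball_subset_closedBall hz.1)))
    | cons a s ih =>
      have hsb' : ∀ z ∈ s, z ∈ ball c r := fun z hz => hsb z (Multiset.mem_cons_of_mem hz)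
      set G : ℂ → ℂ := fun z => (s.map (z - ·)).prod * g z with hG
      have hprod : Differentiable ℂ fun z : ℂ => (s.map (z - ·)).prod := by
        clear ih hsb hsb' hG G hfg
        induction s using Multiset.induction_on with
        | empty => simp
        | cons b s ih => simp only [Multiset.map_cons, Multiset.prod_cons]; fun_prop
      have hGd : Differentiable ℂ G := hprod.mul hg
      have hFG : F = fun z => (z - a) * G z := by
        ext z; rw [hfg]; simp [hG, mul_assoc]
      have ha := hsb a (Multiset.mem_cons_self a s)
      have hGs : ∀ z ∈ sphere c r, G z ≠ 0 := by
        intro z hz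
        refine mul_ne_zero ?_ (hg0 z (sphere_subset_closedBall hz))
        rw [Ne, Multiset.prod_eq_zero_iff, Multiset.mem_map]
        rintro ⟨w, hw, hzw⟩
        rw [sub_eq_zero.1 hzw] at hz
        exact (hsb' w hw).ne hz
      have has : ∀ z ∈ sphere c r, z - a ≠ 0 := by
        rintro z hz h
        rw [sub_eq_zero.1 h] at hz
        exact ha.ne hz
      have hGc : Continuous (deriv G) := (hGd.contDiff (n := 1)).continuous_deriv le_rfl
      have key : (∮ z in C(c, r), Q z * (deriv F z / F z)) =
          ∮ z in C(c, r), (Q z / (z - a) + Q z * (deriv G z / G z)) := by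
        refine circleIntegral.integral_congr hr.le fun z hz => ?_
        have hd : deriv F z = G z + (z - a) * deriv G z := by
          rw [hFG]
          have h : HasDerivAt (fun z => (z - a) * G z) (1 * G z + (z - a) * deriv G z) z :=
            ((hasDerivAt_id z).sub_const a).mul (hGd z).hasDerivAt
          simpa using h.deriv
        have h1 := has z hz
        have h2 := hGs z hz
        simp only [hd]
        rw [hFG]
        field_simp
      rw [key, circleIntegral.integral_add, ih (F := G) hGd (fun z => rfl) hsb']
      · have := (hQ.differentiableOn (s := closedBall c r)).circleIntegral_sub_inv_smul ha
        simp only [smul_eq_mul] at this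
        simp only [Multiset.map_cons, Multiset.sum_cons, mul_add]
        rw [← this]
        congr 1
        refine circleIntegral.integral_congr hr.le fun z hz => ?_
        simp only [div_eq_inv_mul]
      · refine ContinuousOn.circleIntegrable hr.le ?_
        exact hQ.continuous.continuousOn.div (by fun_prop) has
      · refine ContinuousOn.circleIntegrable hr.le ?_
        exact hQ.continuous.continuousOn.mul
          (hGc.continuousOn.div hGd.continuous.continuousOn hGs)

/-! ### The maximum principle on zero sets -/

open Metric in
theorem differentiableAt_circleIntegral_param {J : ℂ × ℂ → ℂ} {U : Set (ℂ × ℂ)} (hU : IsOpen U)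
    (hJ : ContDiffOn ℂ 1 J U) {w₀ c : ℂ} {r : ℝ} (hr : 0 ≤ r)
    (h : ∀ z ∈ sphere c r, (w₀, z) ∈ U) :
    DifferentiableAt ℂ (fun w => ∮ z in C(c, r), J (w, z)) w₀ := by
  obtain ⟨u, v, hu, -, hwu, hcv, huv⟩ := generalized_tube_lemma (isCompact_singleton (x := w₀))
    (isCompact_sphere c r) hU (by rintro ⟨w, z⟩ ⟨hw, hz⟩; obtain rfl : w = w₀ := hw; exact h z hz)
  obtain ⟨ρ, hρ, hρu⟩ := nhds_basis_closedBall.mem_iff.1 (hu.mem_nhds (hwu rfl))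
  have hsub : closedBall w₀ ρ ×ˢ sphere c r ⊆ U := (Set.prod_mono hρu hcv).trans huv
  set J' : ℂ × ℂ → ℂ := fun x => fderiv ℂ J x (1, 0) with hJ'
  have hJ'c : ContinuousOn J' U :=
    (hJ.continuousOn_fderiv_of_isOpen hU le_rfl).clm_apply continuousOn_const
  obtain ⟨C, hC⟩ := ((isCompact_closedBall w₀ ρ).prod (isCompact_sphere c r)).exists_bound_of_continuousOn
    (hJ'c.mono hsub)
  have hmaps : ∀ w ∈ closedBall w₀ ρ, ∀ θ : ℝ, (w, circleMap c r θ) ∈ U := fun w hw θ =>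
    hsub ⟨hw, circleMap_mem_sphere c hr θ⟩
  have hcont : ∀ {G : ℂ × ℂ → ℂ}, ContinuousOn G U → ∀ w ∈ closedBall w₀ ρ,
      Continuous fun θ : ℝ => deriv (circleMap c r) θ * G (w, circleMap c r θ) := by
    intro G hG w hw
    refine Continuous.mul (by rw [funext (deriv_circleMap c r)]; fun_prop) ?_
    exact hG.comp_continuous (by fun_prop) (hmaps w hw)
  have hw₀ : w₀ ∈ closedBall w₀ ρ := mem_closedBall_self hρ.le
  refine (intervalIntegral.hasDerivAt_integral_of_dominated_loc_of_deriv_le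
    (F := fun w θ => deriv (circleMap c r) θ * J (w, circleMap c r θ))
    (F' := fun w θ => deriv (circleMap c r) θ * J' (w, circleMap c r θ))
    (bound := fun _ => |r| * C) (closedBall_mem_nhds w₀ hρ) ?_ ?_ ?_ ?_ ?_ ?_).2.differentiableAt
  · filter_upwards [closedBall_mem_nhds w₀ hρ] with w hw
    exact (hcont hJ.continuousOn w hw).aestronglyMeasurable
  · exact (hcont hJ.continuousOn w₀ hw₀).intervalIntegrable _ _
  · exact (hcont hJ'c w₀ hw₀).aestronglyMeasurable
  · refine Filter.Eventually.of_forall fun θ _ w hw => ?_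
    rw [norm_mul]
    refine mul_le_mul (by simp) (hC _ ⟨hw, circleMap_mem_sphere c hr θ⟩) (norm_nonneg _)
      (abs_nonneg r)
  · exact intervalIntegrable_const
  · refine Filter.Eventually.of_forall fun θ _ w hw => ?_
    refine HasDerivAt.const_mul _ ?_
    have h1 : HasFDerivAt J (fderiv ℂ J (w, circleMap c r θ)) (w, circleMap c r θ) :=
      ((hJ.contDiffAt (hU.mem_nhds (hmaps w hw θ))).differentiableAt (by simp)).hasFDerivAt
    have h2 : HasDerivAt (fun w : ℂ => (w, circleMap c r θ)) ((1 : ℂ), (0 : ℂ)) w :=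
      (hasDerivAt_id w).prodMk (hasDerivAt_const w _)
    exact h1.comp_hasDerivAt w h2

theorem multiset_sum_nonpos {s : Multiset ℝ} (h : ∀ x ∈ s, x ≤ 0) : s.sum ≤ 0 := by
  simpa using Multiset.sum_le_card_nsmul s 0 h

open Metric in
/-- A local maximum principle on a fibred piece of an analytic curve in `ℂ²`. -/
theorem norm_eq_of_zero_of_forall_le {f q : ℂ × ℂ → ℂ} (hf : ContDiff ℂ 2 f) (hq : ContDiff ℂ 2 q)
    {a₁ a₂ : ℂ} {r ρ : ℝ} (hr : 0 < r)
    (h0 : ∀ w ∈ ball a₁ ρ, ∀ z ∈ sphere a₂ r, f (w, z) ≠ 0)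
    (ha : ∀ z ∈ ball a₂ r, f (a₁, z) = 0 → z = a₂)
    (hle : ∀ w ∈ ball a₁ ρ, ∀ z ∈ ball a₂ r, f (w, z) = 0 → ‖q (w, z)‖ ≤ ‖q (a₁, a₂)‖)
    {w z : ℂ} (hw : w ∈ ball a₁ ρ) (hz : z ∈ ball a₂ r) (hwz : f (w, z) = 0) :
    ‖q (w, z)‖ = ‖q (a₁, a₂)‖ := by
  set l := q (a₁, a₂) with hl
  -- Where `‖q‖ ≤ ‖l‖`, the real part of `Q` is nonpositive, and it vanishes only if `‖q‖ = ‖l‖`.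
  -- Unlike `‖q‖`, the function `Q` can be summed holomorphically over the fibre.
  set Q : ℂ × ℂ → ℂ := fun x => (starRingEnd ℂ) l * q x - (starRingEnd ℂ) l * l with hQ
  have hQc : ContDiff ℂ 2 Q := (contDiff_const.mul hq).sub contDiff_const
  have hQre : ∀ x, ‖q x‖ ≤ ‖l‖ → (Q x).re ≤ 0 ∧ ((Q x).re = 0 → ‖q x‖ = ‖l‖) := by
    intro x hx
    have h1 : (Q x).re = ((starRingEnd ℂ) l * q x).re - ‖l‖ ^ 2 := by
      simp only [hQ, Complex.sub_re, Complex.conj_mul']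
      norm_cast
    have h2 : ((starRingEnd ℂ) l * q x).re ≤ ‖l‖ * ‖q x‖ := by
      refine (Complex.re_le_norm _).trans ?_
      rw [norm_mul, RCLike.norm_conj]
    have h3 := norm_nonneg l
    have h4 := norm_nonneg (q x)
    refine ⟨by nlinarith, fun h => ?_⟩
    by_contra hne
    have hlt : ‖q x‖ < ‖l‖ := lt_of_le_of_ne hx hne
    nlinarith
  set fz : ℂ × ℂ → ℂ := fun x => fderiv ℂ f x (0, 1) with hfz
  have hfzc : ContDiff ℂ 1 fz := (hf.fderiv_right (by norm_num)).clm_apply contDiff_const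
  have hfd : Differentiable ℂ f := hf.differentiable (by norm_num)
  have hderiv : ∀ w z, deriv (fun z => f (w, z)) z = fz (w, z) := fun w z =>
    ((hfd (w, z)).hasFDerivAt.comp_hasDerivAt z
      ((hasDerivAt_const z w).prodMk (hasDerivAt_id z))).deriv
  have hslice : ∀ {g : ℂ × ℂ → ℂ}, ContDiff ℂ 2 g → ∀ w, Differentiable ℂ fun z => g (w, z) :=
    fun hg w => (hg.differentiable (by norm_num)).comp (by fun_prop)
  -- By residues this is `2πi` times the sum of `Q` over the zeros in the fibre, with multiplicity;
  -- as an integral it is holomorphic in `w`, even where zeros collide.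
  set D : ℂ → ℂ := fun w => ∮ z in C(a₂, r), Q (w, z) * (fz (w, z) / f (w, z)) with hD
  have hDd : DifferentiableOn ℂ D (ball a₁ ρ) := by
    intro w hw
    refine (differentiableAt_circleIntegral_param (U := {x | f x ≠ 0})
      (J := fun x => Q x * (fz x / f x)) (isOpen_ne_fun hf.continuous continuous_const) ?_ hr.le
      (fun z hz => h0 w hw z hz)).differentiableWithinAt
    exact (hQc.of_le (by norm_num)).contDiffOn.mul
      (hfzc.contDiffOn.div (hf.of_le (by norm_num)).contDiffOn fun x hx => hx)
  have hsum : ∀ w ∈ ball a₁ ρ, ∃ s : Multiset ℂ, (∀ z, z ∈ s ↔ z ∈ ball a₂ r ∧ f (w, z) = 0) ∧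
      D w = 2 * Real.pi * Complex.I * (s.map fun z => Q (w, z)).sum := by
    intro w hw
    obtain ⟨s, hs, hsQ⟩ := circleIntegral_mul_logDeriv (hslice hf w) hr (h0 w hw)
    refine ⟨s, hs, ?_⟩
    rw [← hsQ _ (hslice hQc w)]
    simp only [hderiv, hD]
  have hpi : (2 * Real.pi * Complex.I : ℂ) ≠ 0 := Complex.two_pi_I_ne_zero
  have hre_sum : ∀ (s : Multiset ℂ) (g : ℂ → ℂ), (s.map g).sum.re = (s.map fun z => (g z).re).sum :=
    fun s g => by
      induction s using Multiset.induction_on with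
      | empty => simp
      | cons a s ih => simp [ih]
  set E : ℂ → ℂ := fun w => Complex.exp (D w / (2 * Real.pi * Complex.I)) with hE
  have hEd : DifferentiableOn ℂ E (ball a₁ ρ) := (hDd.div_const _).cexp
  have hEn : ∀ w, ‖E w‖ = Real.exp (D w / (2 * Real.pi * Complex.I)).re :=
    fun w => Complex.norm_exp _
  have haρ : a₁ ∈ ball a₁ ρ := mem_ball_self (dist_nonneg.trans_lt hw)
  have hEa : ‖E a₁‖ = 1 := by
    obtain ⟨s, hs, hsD⟩ := hsum a₁ haρ
    have : (s.map fun z => Q (a₁, z)).sum = 0 := by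
      refine Multiset.sum_eq_zero fun x hx => ?_
      obtain ⟨z, hz, rfl⟩ := Multiset.mem_map.1 hx
      rw [ha z ((hs z).1 hz).1 ((hs z).1 hz).2]
      simp [hQ, ← hl]
    rw [hEn, hsD, this]; simp
  have hElew : ∀ w ∈ ball a₁ ρ, ‖E w‖ ≤ 1 := by
    intro w hw
    obtain ⟨s, hs, hsD⟩ := hsum w hw
    rw [hEn, hsD, mul_div_cancel_left₀ _ hpi, Real.exp_le_one_iff, hre_sum]
    refine multiset_sum_nonpos fun x hx => ?_
    obtain ⟨z, hz, rfl⟩ := Multiset.mem_map.1 hx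
    exact (hQre _ (hle w hw z ((hs z).1 hz).1 ((hs z).1 hz).2)).1
  have hEw : ‖E w‖ = 1 := by
    rw [← hEa]
    refine Complex.norm_eqOn_of_isPreconnected_of_isMaxOn (convex_ball a₁ ρ).isPreconnected
      isOpen_ball hEd haρ ?_ hw
    intro w' hw'
    simpa [hEa] using hElew w' hw'
  obtain ⟨s, hs, hsD⟩ := hsum w hw
  have hzs : z ∈ s := (hs z).2 ⟨hz, hwz⟩
  rw [hEn, hsD, mul_div_cancel_left₀ _ hpi, Real.exp_eq_one_iff, hre_sum] at hEw
  refine (hQre _ (hle w hw z hz hwz)).2 (le_antisymm (hQre _ (hle w hw z hz hwz)).1 ?_)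
  obtain ⟨t, rfl⟩ := Multiset.exists_cons_of_mem hzs
  rw [Multiset.map_cons, Multiset.sum_cons] at hEw
  have : (t.map fun z => (Q (w, z)).re).sum ≤ 0 := by
    refine multiset_sum_nonpos fun x hx => ?_
    obtain ⟨y, hy, rfl⟩ := Multiset.mem_map.1 hx
    have hy' := (hs y).1 (Multiset.mem_cons_of_mem hy)
    exact (hQre _ (hle w hw y hy'.1 hy'.2)).1
  linarith

-- A zero persists under perturbation: otherwise the maximum principle for `1 / f(w, ·)` would bound
-- `‖f(w, a₂)‖` below by `ε / 2`, although it is small for `w` near `a₁`.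
open Metric in
theorem eventually_exists_zero {f : ℂ × ℂ → ℂ} (hf : Differentiable ℂ f) {a₁ a₂ : ℂ} {r : ℝ}
    (hr : 0 < r) (ha : f (a₁, a₂) = 0) (h0 : ∀ z ∈ sphere a₂ r, f (a₁, z) ≠ 0) :
    ∀ᶠ w in nhds a₁, (∀ z ∈ sphere a₂ r, f (w, z) ≠ 0) ∧ ∃ z ∈ ball a₂ r, f (w, z) = 0 := by
  have hfc := hf.continuous
  obtain ⟨z₀, hz₀, hmin⟩ := (isCompact_sphere a₂ r).exists_isMinOn
    ((NormedSpace.sphere_nonempty (x := a₂)).2 hr.le)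
    (f := fun z => ‖f (a₁, z)‖) (by fun_prop)
  set ε := ‖f (a₁, z₀)‖ with hε
  have hεpos : 0 < ε := norm_pos_iff.2 (h0 z₀ hz₀)
  have hev1 : ∀ᶠ w in nhds a₁, ∀ z ∈ sphere a₂ r, ε / 2 < ‖f (w, z)‖ := by
    refine (isCompact_sphere a₂ r).eventually_forall_of_forall_eventually fun z hz => ?_
    have h1 : ε / 2 < ‖f (a₁, z)‖ := (half_lt_self hεpos).trans_le (hmin hz)
    exact (hfc.norm.tendsto (a₁, z)).eventually (lt_mem_nhds h1)
  have hev2 : ∀ᶠ w in nhds a₁, ‖f (w, a₂)‖ < ε / 2 := by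
    have : Continuous fun w => ‖f (w, a₂)‖ := by fun_prop
    exact (this.tendsto a₁).eventually (gt_mem_nhds (by simpa [ha] using hεpos))
  filter_upwards [hev1, hev2] with w hw1 hw2
  refine ⟨fun z hz h => ?_, ?_⟩
  · have := hw1 z hz
    rw [h, norm_zero] at this
    linarith
  · by_contra! hne
    have hne' : ∀ z ∈ closedBall a₂ r, f (w, z) ≠ 0 := by
      intro z hz
      rw [← ball_union_sphere] at hz
      rcases hz with hz | hz
      · exact hne z hz
      · intro h
        have := hw1 z hz
        rw [h, norm_zero] at this
        linarith
    have hd : DiffContOnCl ℂ (fun z => (f (w, z))⁻¹) (ball a₂ r) := by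
      refine DifferentiableOn.diffContOnCl ?_
      rw [closure_ball _ hr.ne']
      exact DifferentiableOn.inv (hf.comp (by fun_prop)).differentiableOn hne'
    have := Complex.norm_le_of_forall_mem_frontier_norm_le isBounded_ball hd (C := (ε / 2)⁻¹)
      (fun z hz => by
        rw [frontier_ball _ hr.ne'] at hz
        rw [norm_inv]
        exact inv_anti₀ (by positivity) (hw1 z hz).le) (subset_closure (mem_ball_self hr))
    rw [norm_inv] at this
    have h2 := (inv_le_inv₀ (norm_pos_iff.2 (hne' a₂ (mem_closedBall_self hr.le)))
      (by positivity)).1 this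
    linarith

open Metric in
/-- The maximum principle on the zero set of an entire function on `ℂ²`. -/
theorem exists_mem_frontier_zero_norm_le {f q : ℂ × ℂ → ℂ} (hf : ContDiff ℂ 2 f)
    (hq : ContDiff ℂ 2 q) {Ω : Set (ℂ × ℂ)} (hΩ : IsOpen Ω) (hb : Bornology.IsBounded Ω)
    {x₀ : ℂ × ℂ} (hx₀ : x₀ ∈ Ω) (hfx : f x₀ = 0) :
    ∃ b ∈ frontier Ω, f b = 0 ∧ ‖q x₀‖ ≤ ‖q b‖ := by
  by_contra! hcon
  have hfd : Differentiable ℂ f := hf.differentiable (by norm_num)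
  have hqd : Differentiable ℂ q := hq.differentiable (by norm_num)
  have hVc : IsCompact (closure Ω ∩ {x | f x = 0}) :=
    hb.isCompact_closure.inter_right (isClosed_eq hf.continuous continuous_const)
  obtain ⟨m, hmV, hm⟩ := hVc.exists_isMaxOn ⟨x₀, subset_closure hx₀, hfx⟩
    (f := fun x => ‖q x‖) (hq.continuous.norm.continuousOn)
  have hKc : IsCompact ((closure Ω ∩ {x | f x = 0}) ∩ {x | ‖q x‖ = ‖q m‖}) :=
    hVc.inter_right (isClosed_eq hq.continuous.norm continuous_const)
  -- Among the maximum points of `‖q‖`, one is taken with extremal first coordinate; spreading the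
  -- maximum to nearby fibres will contradict this choice.
  obtain ⟨⟨a₁, a₂⟩, ⟨⟨haΩ, hfa⟩, hqa⟩, hamax⟩ := hKc.exists_isMaxOn ⟨m, hmV, rfl⟩
    (f := fun x => x.1.re) (by fun_prop)
  simp only [Set.mem_ofPred_eq] at hfa hqa
  have hx₀m : ‖q x₀‖ ≤ ‖q m‖ := hm ⟨subset_closure hx₀, hfx⟩
  have haΩ' : (a₁, a₂) ∈ Ω := by
    by_contra h
    have := hcon (a₁, a₂) ⟨haΩ, by rwa [hΩ.interior_eq]⟩ hfa
    rw [hqa] at this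
    linarith
  have hfs : Differentiable ℂ fun z => f (a₁, z) := hfd.comp (by fun_prop)
  -- Either the whole vertical line lies in the zero set, and the one-variable maximum principle
  -- reaches the boundary, or `a₂` is an isolated zero in its fibre.
  rcases (hfs.analyticAt a₂).eventually_eq_zero_or_eventually_ne_zero with h | h
  · have hzero : (fun z => f (a₁, z)) = 0 :=
      AnalyticOnNhd.eq_of_eventuallyEq (fun w _ => hfs.analyticAt w)
        (fun w _ => analyticAt_const) h
    have hcs : Continuous fun z : ℂ => (a₁, z) := by fun_prop
    have hSb : Bornology.IsBounded ((fun z : ℂ => (a₁, z)) ⁻¹' Ω) :=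
      hb.image_snd.subset fun z hz => ⟨(a₁, z), hz, rfl⟩
    obtain ⟨z, hz, hzmax⟩ := Complex.exists_mem_frontier_isMaxOn_norm (f := fun z => q (a₁, z))
      hSb ⟨a₂, haΩ'⟩ (Differentiable.diffContOnCl (hqd.comp (by fun_prop)))
    have h1 : ‖q (a₁, a₂)‖ ≤ ‖q (a₁, z)‖ := hzmax (subset_closure (show a₂ ∈ _ from haΩ'))
    have h2 := hcon (a₁, z) (hcs.frontier_preimage_subset Ω hz) (congrFun hzero z)
    rw [hqa] at h1
    linarith
  · have hev : ∀ᶠ z in nhds a₂, z ≠ a₂ → f (a₁, z) ≠ 0 := eventually_nhdsWithin_iff.1 h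
    obtain ⟨r, hr, hrsub⟩ := nhds_basis_closedBall.eventually_iff.1 hev
    obtain ⟨ε, hε, hεΩ⟩ := Metric.isOpen_iff.1 hΩ _ haΩ'
    set r' := min r (ε / 2) with hr'
    have hr'pos : 0 < r' := lt_min hr (half_pos hε)
    have hne : ∀ z ∈ closedBall a₂ r', z ≠ a₂ → f (a₁, z) ≠ 0 := fun z hz =>
      hrsub (closedBall_subset_closedBall (min_le_left _ _) hz)
    have hsph : ∀ z ∈ sphere a₂ r', f (a₁, z) ≠ 0 := fun z hz =>
      hne z (sphere_subset_closedBall hz) (ne_of_mem_sphere hz hr'pos.ne')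
    obtain ⟨ρ, hρ, hρsub⟩ := nhds_basis_ball.eventually_iff.1
      (eventually_exists_zero hfd hr'pos hfa hsph)
    set ρ' := min ρ ε with hρ'
    have hρ'pos : 0 < ρ' := lt_min hρ hε
    have hin : ∀ w ∈ ball a₁ ρ', ∀ z ∈ ball a₂ r', (w, z) ∈ Ω := by
      intro w hw z hz
      refine hεΩ ?_
      rw [← ball_prod_same]
      refine ⟨ball_subset_ball (min_le_right _ _) hw, ball_subset_ball ?_ hz⟩
      exact (min_le_right _ _).trans (half_le_self hε.le)
    set w : ℂ := a₁ + ((ρ' / 2 : ℝ) : ℂ) with hw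
    have hwb : w ∈ ball a₁ ρ' := by
      rw [mem_ball, dist_eq_norm, hw, add_sub_cancel_left, Complex.norm_real, Real.norm_eq_abs,
        abs_of_pos (half_pos hρ'pos)]
      exact half_lt_self hρ'pos
    obtain ⟨-, z, hz, hwz⟩ := hρsub (ball_subset_ball (min_le_left _ _) hwb)
    have heq := norm_eq_of_zero_of_forall_le hf hq (a₁ := a₁) (a₂ := a₂) (ρ := ρ') hr'pos
      (fun w hw => (hρsub (ball_subset_ball (min_le_left _ _) hw)).1)
      (fun z hz hfz => by
        by_contra hza
        exact hne z (ball_subset_closedBall hz) hza hfz)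
      (fun w hw z hz hfz => by
        rw [hqa]; exact hm ⟨subset_closure (hin w hw z hz), hfz⟩) hwb hz hwz
    have := hamax (a := (w, z)) ⟨⟨subset_closure (hin w hwb z hz), hwz⟩, heq.trans hqa⟩
    simp only [hw, Set.mem_ofPred_eq, Complex.add_re, Complex.ofReal_re] at this
    linarith

/-- Restrict to the complex 2-plane through `x₀` in the first two coordinate directions; boundary
points of the slice are boundary points of `Ω`. -/
theorem exists_mem_frontier_zero_norm_le_pi {N : ℕ} (hN : 2 ≤ N) {f q : (Fin N → ℂ) → ℂ}
    (hf : ContDiff ℂ 2 f) (hq : ContDiff ℂ 2 q) {Ω : Set (Fin N → ℂ)} (hΩ : IsOpen Ω)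
    (hb : Bornology.IsBounded Ω) {x₀ : Fin N → ℂ} (hx₀ : x₀ ∈ Ω) (hfx : f x₀ = 0) :
    ∃ b ∈ frontier Ω, f b = 0 ∧ ‖q x₀‖ ≤ ‖q b‖ := by
  set i₀ : Fin N := ⟨0, by omega⟩ with hi₀
  set i₁ : Fin N := ⟨1, by omega⟩ with hi₁
  have h01 : i₀ ≠ i₁ := by simp [hi₀, hi₁]
  set A : ℂ × ℂ → Fin N → ℂ := fun p => x₀ + (p.1 • Pi.single i₀ 1 + p.2 • Pi.single i₁ 1) with hA
  have hAd : ContDiff ℂ 2 A := by fun_prop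
  have hA0 : A 0 = x₀ := by simp [hA]
  have hA₀ : ∀ p, (A p - x₀) i₀ = p.1 := fun p => by simp [hA, h01]
  have hA₁ : ∀ p, (A p - x₀) i₁ = p.2 := fun p => by simp [hA, h01.symm]
  obtain ⟨R, hR⟩ := hb.exists_norm_le
  have hbA : Bornology.IsBounded (A ⁻¹' Ω) := by
    refine isBounded_iff_forall_norm_le.2 ⟨R + ‖x₀‖, fun p hp => ?_⟩
    have h1 : ‖A p - x₀‖ ≤ R + ‖x₀‖ := (norm_sub_le _ _).trans (by gcongr; exact hR _ hp)
    refine (max_le ?_ ?_ : ‖p‖ ≤ _)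
    · rw [← hA₀ p]; exact (norm_le_pi_norm _ _).trans h1
    · rw [← hA₁ p]; exact (norm_le_pi_norm _ _).trans h1
  obtain ⟨b, hbf, hfb, hqb⟩ := exists_mem_frontier_zero_norm_le (f := f ∘ A) (q := q ∘ A)
    (hf.comp hAd) (hq.comp hAd) (hΩ.preimage hAd.continuous) hbA (x₀ := 0)
    (by simpa [hA0] using hx₀) (by simpa [hA0] using hfx)
  exact ⟨A b, hAd.continuous.frontier_preimage_subset Ω hbf, hfb, by simpa [hA0] using hqb⟩

theorem contDiff_eval_mvPolynomial {N : ℕ} (p : MvPolynomial (Fin N) ℂ) {n : WithTop ℕ∞} :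
    ContDiff ℂ n fun z : Fin N → ℂ => MvPolynomial.eval z p := by
  induction p using MvPolynomial.induction_on with
  | C a => simpa using contDiff_const
  | add p q hp hq => simpa using hp.add hq
  | mul_X p i hp => simpa using hp.mul (contDiff_apply ℂ ℂ i)

theorem algHom_apply_smul {B : Type*} [Ring B] [Algebra ℂ B] (φ : B →ₐ[ℂ] ℂ) (c : ℂ) (f : B) :
    φ (c • f) = c * φ f := by
  rw [Algebra.smul_def, map_mul, AlgHom.commutes]; rfl

/-! ### Exponentials and logarithms in uniform algebras -/

section UniformAlgebra

variable {X : Type*} [TopologicalSpace X] [CompactSpace X] {A : Subalgebra ℂ C(X, ℂ)}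

theorem exists_mem_hasSum_pow (hA : IsClosed (A : Set C(X, ℂ))) {a : C(X, ℂ)} (ha : a ∈ A)
    {c : ℕ → ℂ} (hc : Summable fun n => ‖c n‖ * ‖a‖ ^ n) :
    ∃ b ∈ A, ∀ x, HasSum (fun n => c n * a x ^ n) (b x) := by
  have hs : Summable fun n => c n • a ^ n := by
    refine Summable.of_norm_bounded hc fun n => ?_
    rw [ContinuousMap.norm_le _ (by positivity)]
    intro x
    simp only [ContinuousMap.coe_smul, ContinuousMap.coe_pow, Pi.smul_apply, Pi.pow_apply,
      smul_eq_mul, norm_mul, norm_pow]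
    gcongr
    exact a.norm_coe_le_norm x
  refine ⟨∑' n, c n • a ^ n, hA.mem_of_tendsto hs.hasSum (Filter.Eventually.of_forall fun s =>
    A.sum_mem fun n _ => A.smul_mem (A.pow_mem ha n) _), fun x => ?_⟩
  have := hs.hasSum.map (ContinuousMap.evalAlgHom ℂ ℂ x) (by
    change Continuous fun f : C(X, ℂ) => f x
    fun_prop)
  simpa [Function.comp_def] using! this

theorem exists_mem_exp (hA : IsClosed (A : Set C(X, ℂ))) {a : C(X, ℂ)} (ha : a ∈ A) :
    ∃ b ∈ A, ∀ x, b x = Complex.exp (a x) := by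
  obtain ⟨b, hb, h⟩ := exists_mem_hasSum_pow hA ha (c := fun n => (n.factorial : ℂ)⁻¹) (by
    simpa [div_eq_inv_mul] using Real.summable_pow_div_factorial ‖a‖)
  refine ⟨b, hb, fun x => (h x).unique ?_⟩
  rw [Complex.exp_eq_exp_ℂ]
  simpa [div_eq_inv_mul] using NormedSpace.expSeries_div_hasSum_exp (a x)

theorem exists_mem_inv_one_sub (hA : IsClosed (A : Set C(X, ℂ))) {a : C(X, ℂ)} (ha : a ∈ A)
    (h1 : ‖a‖ < 1) : ∃ b ∈ A, ∀ x, b x = (1 - a x)⁻¹ := by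
  obtain ⟨b, hb, h⟩ := exists_mem_hasSum_pow hA ha (c := fun _ => 1) (by
    simpa using summable_geometric_of_lt_one (norm_nonneg a) h1)
  refine ⟨b, hb, fun x => (h x).unique ?_⟩
  simpa using hasSum_geometric_of_norm_lt_one ((a.norm_coe_le_norm x).trans_lt h1)

theorem exists_mem_exp_eq_one_sub (hA : IsClosed (A : Set C(X, ℂ))) {a : C(X, ℂ)} (ha : a ∈ A)
    (h1 : ‖a‖ < 1) : ∃ b ∈ A, ∀ x, Complex.exp (b x) = 1 - a x := by
  obtain ⟨b, hb, h⟩ := exists_mem_hasSum_pow hA ha (c := fun n => (n : ℂ)⁻¹) (by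
    refine Summable.of_nonneg_of_le (fun n => by positivity) (fun n => ?_)
      (summable_geometric_of_lt_one (norm_nonneg a) h1)
    refine mul_le_of_le_one_left (by positivity) ?_
    rw [norm_inv, Complex.norm_natCast]
    exact Nat.cast_inv_le_one n)
  refine ⟨-b, A.neg_mem hb, fun x => ?_⟩
  have hx : ‖a x‖ < 1 := (a.norm_coe_le_norm x).trans_lt h1
  have hlog : b x = -Complex.log (1 - a x) := by
    refine (h x).unique ?_
    simpa [div_eq_inv_mul] using Complex.hasSum_taylorSeries_neg_log hx
  rw [ContinuousMap.neg_apply, hlog, neg_neg, Complex.exp_log]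
  intro h0
  rw [← sub_eq_zero.1 h0, norm_one] at hx
  exact lt_irrefl _ hx

/-- An element of a uniform algebra with values in a half-plane has a logarithm. -/
theorem exists_mem_exp_eq_of_re (hA : IsClosed (A : Set C(X, ℂ))) {u : C(X, ℂ)} (hu : u ∈ A)
    {ε : ℝ} (hε : 0 < ε) (h : ∀ x, ε ≤ (u x).re) :
    ∃ b ∈ A, ∀ x, Complex.exp (b x) = u x := by
  -- This `R` makes `|R - u|² ≤ R² - 2εR + ‖u‖² < R²`, so `u / R` lies within distance less than 1
  -- of the constant 1 and the logarithm series applies.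
  obtain ⟨R, hR, hRu⟩ : ∃ R : ℝ, 0 < R ∧ ‖u‖ ^ 2 < 2 * ε * R := by
    refine ⟨(‖u‖ ^ 2 + 1) / (2 * ε), by positivity, ?_⟩
    rw [mul_div_cancel₀ _ (by positivity)]
    linarith
  obtain ⟨b, hb, hexp⟩ := exists_mem_exp_eq_one_sub hA (a := 1 - (R⁻¹ : ℂ) • u)
    (A.sub_mem A.one_mem (A.smul_mem hu _)) (by
      rw [ContinuousMap.norm_lt_iff _ one_pos]
      intro x
      have h1 := h x
      have h2 : Complex.normSq (u x) ≤ ‖u‖ ^ 2 := by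
        rw [Complex.normSq_eq_norm_sq]
        gcongr
        exact u.norm_coe_le_norm x
      rw [← sq_lt_one_iff₀ (norm_nonneg _), ← Complex.normSq_eq_norm_sq]
      have h3 : (1 - (R⁻¹ : ℂ) • u) x = (R⁻¹ : ℂ) * (R - u x) := by
        have : (R : ℂ) ≠ 0 := by exact_mod_cast hR.ne'
        simp [mul_sub, this]
      rw [h3, Complex.normSq_mul, Complex.normSq_inv, Complex.normSq_ofReal,
        inv_mul_lt_one₀ (by positivity)]
      rw [Complex.normSq_apply] at h2 ⊢
      simp only [Complex.sub_re, Complex.ofReal_re, Complex.sub_im, Complex.ofReal_im]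
      nlinarith)
  refine ⟨b + algebraMap ℂ _ (Real.log R), A.add_mem hb (A.algebraMap_mem _), fun x => ?_⟩
  have h1 : (R : ℂ) ≠ 0 := by exact_mod_cast hR.ne'
  have h2 : Complex.exp (Real.log R) = R := by rw [← Complex.ofReal_exp, Real.exp_log hR]
  simp [Complex.exp_add, hexp, h2, h1, mul_comm]

/-! ### Characters and Gleason parts -/

theorem norm_algHom_apply_le (hA : IsClosed (A : Set C(X, ℂ))) (φ : A →ₐ[ℂ] ℂ) (f : A) :
    ‖φ f‖ ≤ ‖f‖ := by
  have : CompleteSpace A := hA.completeSpace_coe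
  have h1 : ‖(1 : A)‖ ≤ 1 := (ContinuousMap.norm_le (1 : C(X, ℂ)) zero_le_one).2 (by simp)
  refine (AlgHom.norm_apply_le_self_mul_norm_one φ f).trans ?_
  exact mul_le_of_le_one_right (norm_nonneg _) h1

/-- `G` is the disc automorphism `(h - b) / (1 - b h)`; with the denominator cleared, characters can
be applied directly. -/
theorem exists_norm_le_one_of_mobius (hA : IsClosed (A : Set C(X, ℂ))) {h : A} (hh : ‖h‖ ≤ 1)
    {b : ℝ} (hb0 : 0 ≤ b) (hb1 : b < 1) :
    ∃ G : A, ‖G‖ ≤ 1 ∧ G * (1 - (b : ℂ) • h) = h - algebraMap ℂ A b := by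
  have hbh : ‖((b : ℂ) • h : A)‖ < 1 := by
    rw [norm_smul, Complex.norm_real, Real.norm_of_nonneg hb0]
    nlinarith [norm_nonneg h]
  obtain ⟨v, hv, hvx⟩ := exists_mem_inv_one_sub hA (a := (((b : ℂ) • h : A) : C(X, ℂ)))
    (SetLike.coe_mem _) hbh
  have hlt : ∀ x, ‖(b : ℂ) * (h : C(X, ℂ)) x‖ < 1 := fun x =>
    (ContinuousMap.norm_coe_le_norm (((b : ℂ) • h : A) : C(X, ℂ)) x).trans_lt hbh
  have hne : ∀ x, 1 - (b : ℂ) * (h : C(X, ℂ)) x ≠ 0 := by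
    intro x hx
    have := hlt x
    rw [← sub_eq_zero.1 hx, norm_one] at this
    exact lt_irrefl _ this
  refine ⟨(h - algebraMap ℂ A b) * ⟨v, hv⟩, ?_, ?_⟩
  · refine (ContinuousMap.norm_le _ zero_le_one).2 fun x => ?_
    have hx : ‖(h : C(X, ℂ)) x‖ ≤ 1 := (ContinuousMap.norm_coe_le_norm _ x).trans hh
    change ‖((h : C(X, ℂ)) x - (b : ℂ)) * v x‖ ≤ 1
    rw [hvx]
    change ‖((h : C(X, ℂ)) x - (b : ℂ)) * (1 - (b : ℂ) * (h : C(X, ℂ)) x)⁻¹‖ ≤ 1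
    rw [← div_eq_mul_inv, norm_div, div_le_one (norm_pos_iff.2 (hne x)),
      ← sq_le_sq₀ (norm_nonneg _) (norm_nonneg _), ← Complex.normSq_eq_norm_sq,
      ← Complex.normSq_eq_norm_sq]
    rw [← sq_le_one_iff₀ (norm_nonneg _), ← Complex.normSq_eq_norm_sq] at hx
    generalize (h : C(X, ℂ)) x = y at hx ⊢
    rw [Complex.normSq_apply] at hx ⊢
    rw [Complex.normSq_apply]
    simp only [Complex.sub_re, Complex.ofReal_re, Complex.sub_im, Complex.ofReal_im,
      Complex.one_re, Complex.mul_re, Complex.one_im, Complex.mul_im]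
    have hb2 : 0 ≤ 1 - b ^ 2 := by nlinarith
    nlinarith [mul_nonneg hb2 (sub_nonneg.2 hx)]
  · ext x
    change (((h : C(X, ℂ)) x - (b : ℂ)) * v x) * (1 - (b : ℂ) * (h : C(X, ℂ)) x) =
      (h : C(X, ℂ)) x - (b : ℂ)
    rw [hvx]
    exact inv_mul_cancel_right₀ (hne x) _

theorem exists_norm_le_half_of_ne {φ ψ : A →ₐ[ℂ] ℂ} (hne : φ ≠ ψ) :
    ∃ f : A, φ f = 0 ∧ ψ f ≠ 0 ∧ ‖f‖ ≤ 1 / 2 := by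
  obtain ⟨f, hf⟩ : ∃ f, ψ f ≠ φ f := by
    by_contra! h
    exact hne (AlgHom.ext fun f => (h f).symm)
  set f₁ : A := f - algebraMap ℂ A (φ f) with hf₁
  have h0 : φ f₁ = 0 := by rw [hf₁, map_sub, AlgHom.commutes]; exact sub_self _
  have h1 : ψ f₁ ≠ 0 := by
    rw [hf₁, map_sub, AlgHom.commutes]
    exact sub_ne_zero.2 hf
  have hpos : (0 : ℝ) < 2 * (‖f₁‖ + 1) := by positivity
  refine ⟨((2 * (‖f₁‖ + 1) : ℝ) : ℂ)⁻¹ • f₁, by rw [algHom_apply_smul, h0, mul_zero], ?_, ?_⟩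
  · rw [algHom_apply_smul]
    exact mul_ne_zero (inv_ne_zero (by exact_mod_cast hpos.ne')) h1
  · rw [norm_smul, norm_inv, Complex.norm_real, Real.norm_of_nonneg hpos.le,
      inv_mul_le_iff₀ hpos]
    linarith [norm_nonneg f₁]

theorem exists_norm_le_one_pow_eq (hA : IsClosed (A : Set C(X, ℂ))) {u g : A} (hu : ‖u‖ ≤ 1)
    (hug : ∀ x, (u : C(X, ℂ)) x = Complex.exp ((g : C(X, ℂ)) x)) {M : ℕ} (hM : M ≠ 0) :
    ∃ h : A, ‖h‖ ≤ 1 ∧ h ^ M = u := by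
  obtain ⟨h, hhA, hhx⟩ := exists_mem_exp hA (A.smul_mem g.2 ((M : ℂ)⁻¹))
  have hpow : (⟨h, hhA⟩ : A) ^ M = u := by
    ext x
    change h x ^ M = (u : C(X, ℂ)) x
    rw [hhx, hug, ← Complex.exp_nat_mul]
    simp [hM]
  refine ⟨⟨h, hhA⟩, (ContinuousMap.norm_le h zero_le_one).2 fun x => ?_, hpow⟩
  rw [← pow_le_one_iff_of_nonneg (norm_nonneg _) hM, ← norm_pow]
  change ‖(((⟨h, hhA⟩ : A) ^ M : A) : C(X, ℂ)) x‖ ≤ 1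
  rw [hpow]
  exact (ContinuousMap.norm_coe_le_norm _ x).trans hu

/-- If the exponentials are dense, two characters are separated by elements of the unit ball with
values near `0` and near the unit circle. -/
theorem exists_norm_le_one_small_large (hA : IsClosed (A : Set C(X, ℂ)))
    (hd : ∀ f : A, ∀ ε > 0, ∃ u g : A, ‖f - u‖ < ε ∧
      ∀ x, (u : C(X, ℂ)) x = Complex.exp ((g : C(X, ℂ)) x))
    {φ ψ : A →ₐ[ℂ] ℂ} (hne : φ ≠ ψ) {r : ℝ} (hr0 : 0 ≤ r) (hr1 : r < 1) :
    ∃ h : A, ‖h‖ ≤ 1 ∧ ‖φ h‖ ≤ 1 / 2 ∧ r ≤ ‖ψ h‖ := by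
  obtain ⟨f, hφf, hψf, hfn⟩ := exists_norm_le_half_of_ne hne
  set s := ‖ψ f‖ with hs
  have hs0 : 0 < s := norm_pos_iff.2 hψf
  obtain ⟨M, hM0, hM⟩ : ∃ M : ℕ, M ≠ 0 ∧ r ^ M < s / 2 := by
    obtain ⟨M, hM⟩ := exists_pow_lt_of_lt_one (half_pos hs0) hr1
    exact ⟨M + 1, M.succ_ne_zero, (pow_le_pow_of_le_one hr0 hr1.le M.le_succ).trans_lt hM⟩
  -- The three tolerances give, in turn, `‖u‖ ≤ 1`, `‖ψ u‖ ≥ s / 2 > r ^ M`, and `‖φ u‖ ≤ (1/2) ^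
  -- M`. An `M`-th root of `u` then has the required values.
  obtain ⟨u, g, hu, hug⟩ := hd f (min (1 / 2) (min (s / 2) ((1 / 2) ^ M))) (by positivity)
  simp only [lt_inf_iff] at hu
  obtain ⟨hu1, hu2, hu3⟩ := hu
  have hun : ‖u‖ ≤ 1 := by
    have := norm_sub_norm_le u f
    rw [norm_sub_rev] at this
    linarith
  obtain ⟨h, hh1, hpow⟩ := exists_norm_le_one_pow_eq hA hun hug hM0
  refine ⟨h, hh1, ?_, ?_⟩
  · rw [← pow_le_pow_iff_left₀ (norm_nonneg _) (by norm_num) hM0, ← norm_pow, ← map_pow, hpow]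
    have := norm_algHom_apply_le hA φ (f - u)
    rw [map_sub, hφf, zero_sub, norm_neg] at this
    linarith
  · rw [← pow_le_pow_iff_left₀ hr0 (norm_nonneg _) hM0, ← norm_pow, ← map_pow, hpow]
    have h1 := norm_algHom_apply_le hA ψ (f - u)
    rw [map_sub] at h1
    have h2 := norm_sub_norm_le (ψ f) (ψ u)
    linarith

theorem exists_smul_apply_eq_norm (h : A) (ψ : A →ₐ[ℂ] ℂ) (h0 : ψ h ≠ 0) :
    ∃ c : ℂ, ‖c‖ = 1 ∧ ψ (c • h) = (‖ψ h‖ : ℂ) := by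
  have hpos : 0 < ‖ψ h‖ := norm_pos_iff.2 h0
  have hC : (‖ψ h‖ : ℂ) ≠ 0 := by exact_mod_cast hpos.ne'
  refine ⟨(starRingEnd ℂ) (ψ h) / ‖ψ h‖, ?_, ?_⟩
  · rw [norm_div, RCLike.norm_conj, Complex.norm_real, norm_norm, div_self hpos.ne']
  · rw [algHom_apply_smul, div_mul_eq_mul_div, Complex.conj_mul', sq,
      mul_div_cancel_left₀ _ hC]

/-- Here `1 - y = (1 - t)(2 - δ) / (1 - (1 - δ)t)`: the numerator is at most `2δ²` and the
denominator at least `δ`. This is why `t` must be within `δ²` of 1. -/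
theorem norm_sub_one_le_of_mobius {δ t : ℝ} (hδ0 : 0 < δ) (hδ1 : δ < 1) (ht : 1 - δ ^ 2 ≤ t)
    (ht1 : t ≤ 1) {y : ℂ}
    (hy : y * (1 - ((1 - δ : ℝ) : ℂ) * t) = t - ((1 - δ : ℝ) : ℂ)) : ‖y - 1‖ ≤ 2 * δ := by
  have hden : δ ≤ 1 - (1 - δ) * t := by nlinarith
  have hdenC : (1 - ((1 - δ : ℝ) : ℂ) * (t : ℂ)) = ((1 - (1 - δ) * t : ℝ) : ℂ) := by
    push_cast; ring
  have h2 : (y - 1) * ((1 - (1 - δ) * t : ℝ) : ℂ) = ((-((1 - t) * (2 - δ)) : ℝ) : ℂ) := by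
    rw [← hdenC, sub_mul, hy]
    push_cast
    ring
  have h3 := congrArg norm h2
  rw [norm_mul, Complex.norm_real, Complex.norm_real, Real.norm_of_nonneg (by linarith),
    Real.norm_eq_abs, abs_neg,
    abs_of_nonneg (mul_nonneg (sub_nonneg.2 ht1) (by linarith))] at h3
  have h4 : ‖y - 1‖ * δ ≤ 2 * δ * δ := by
    calc ‖y - 1‖ * δ ≤ ‖y - 1‖ * (1 - (1 - δ) * t) := by gcongr
      _ = (1 - t) * (2 - δ) := h3
      _ ≤ δ ^ 2 * 2 := mul_le_mul (by linarith) (by linarith) (by linarith) (by positivity)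
      _ = 2 * δ * δ := by ring
  exact le_of_mul_le_mul_right h4 hδ0

theorem norm_add_one_le_of_mobius {δ : ℝ} (hδ0 : 0 < δ) (hδ1 : δ < 1) {t y : ℂ}
    (ht : ‖t‖ ≤ 1 / 2)
    (hy : y * (1 - ((1 - δ : ℝ) : ℂ) * t) = t - ((1 - δ : ℝ) : ℂ)) : ‖y + 1‖ ≤ 3 * δ := by
  have hb : ‖((1 - δ : ℝ) : ℂ) * t‖ ≤ 1 / 2 := by
    rw [norm_mul, Complex.norm_real, Real.norm_of_nonneg (by linarith)]
    nlinarith [norm_nonneg t]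
  have hden : 1 / 2 ≤ ‖1 - ((1 - δ : ℝ) : ℂ) * t‖ := by
    have := norm_sub_norm_le (1 : ℂ) (((1 - δ : ℝ) : ℂ) * t)
    rw [norm_one] at this
    linarith
  have h2 : (y + 1) * (1 - ((1 - δ : ℝ) : ℂ) * t) = (δ : ℂ) * (1 + t) := by
    rw [add_mul, hy]
    push_cast
    ring
  have h3 := congrArg norm h2
  rw [norm_mul, norm_mul, Complex.norm_real, Real.norm_of_nonneg hδ0.le] at h3
  have h4 : ‖1 + t‖ ≤ 3 / 2 := by
    have := norm_add_le (1 : ℂ) t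
    rw [norm_one] at this
    linarith
  have h5 : ‖y + 1‖ * (1 / 2) ≤ δ * (3 / 2) := by
    calc _ ≤ ‖y + 1‖ * ‖1 - ((1 - δ : ℝ) : ℂ) * t‖ := by gcongr
      _ = δ * ‖1 + t‖ := h3
      _ ≤ _ := by gcongr
  linarith

theorem exists_two_sub_le_norm_sub (hA : IsClosed (A : Set C(X, ℂ)))
    (hd : ∀ f : A, ∀ ε > 0, ∃ u g : A, ‖f - u‖ < ε ∧
      ∀ x, (u : C(X, ℂ)) x = Complex.exp ((g : C(X, ℂ)) x))
    {φ ψ : A →ₐ[ℂ] ℂ} (hne : φ ≠ ψ) {δ : ℝ} (hδ0 : 0 < δ) (hδ1 : δ < 1) :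
    ∃ G : A, ‖G‖ ≤ 1 ∧ 2 - 5 * δ ≤ ‖φ G - ψ G‖ := by
  have hδ2 : δ ^ 2 < 1 := by nlinarith
  obtain ⟨h, hh1, hφh, hψh⟩ := exists_norm_le_one_small_large hA hd hne (r := 1 - δ ^ 2)
    (by linarith) (by nlinarith)
  have hψ0 : ψ h ≠ 0 := norm_pos_iff.1 (lt_of_lt_of_le (by linarith) hψh)
  obtain ⟨c, hc, hψc⟩ := exists_smul_apply_eq_norm h ψ hψ0
  have hk1 : ‖c • h‖ ≤ 1 := by rw [norm_smul, hc, one_mul]; exact hh1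
  have hφk : ‖φ (c • h)‖ ≤ 1 / 2 := by
    rw [algHom_apply_smul, norm_mul, hc, one_mul]; exact hφh
  obtain ⟨G, hG1, hG⟩ := exists_norm_le_one_of_mobius hA hk1 (b := 1 - δ) (by linarith)
    (by linarith)
  have hval : ∀ χ : A →ₐ[ℂ] ℂ,
      χ G * (1 - ((1 - δ : ℝ) : ℂ) * χ (c • h)) = χ (c • h) - ((1 - δ : ℝ) : ℂ) := by
    intro χ
    have := congrArg χ hG
    rwa [map_mul, map_sub, map_sub, map_one, algHom_apply_smul χ _ (c • h), AlgHom.commutes] at this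
  have hψG := norm_sub_one_le_of_mobius hδ0 hδ1 hψh
    ((norm_algHom_apply_le hA ψ h).trans hh1) (hψc ▸ hval ψ)
  have hφG := norm_add_one_le_of_mobius hδ0 hδ1 hφk (hval φ)
  refine ⟨G, hG1, ?_⟩
  have h2 : (2 : ℝ) ≤ ‖φ G - ψ G‖ + ‖ψ G - 1‖ + ‖φ G + 1‖ := by
    have : (2 : ℂ) = -(φ G - ψ G) - (ψ G - 1) + (φ G + 1) := by ring
    calc (2 : ℝ) = ‖(2 : ℂ)‖ := by simp
      _ ≤ _ := by
        rw [this]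
        refine (norm_add_le _ _).trans (add_le_add_left ?_ _)
        refine (norm_sub_le _ _).trans ?_
        rw [norm_neg]
  linarith

/-- If the exponentials are dense in a uniform algebra, then all its Gleason parts are points. -/
theorem isOnePointGleasonPart_of_dense_exp (hA : IsClosed (A : Set C(X, ℂ)))
    (hd : ∀ f : A, ∀ ε > 0, ∃ u g : A, ‖f - u‖ < ε ∧
      ∀ x, (u : C(X, ℂ)) x = Complex.exp ((g : C(X, ℂ)) x))
    (φ : characterSpace ℂ A) : IsOnePointGleasonPart φ := by
  refine Set.eq_singleton_iff_unique_mem.2 ⟨by simp [gleasonPart], fun ψ hψ => ?_⟩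
  by_contra hne
  have hD : ‖CharacterSpace.toCLM φ - CharacterSpace.toCLM ψ‖ < 2 := hψ
  set D := ‖CharacterSpace.toCLM φ - CharacterSpace.toCLM ψ‖ with hDdef
  have hD0 : 0 ≤ D := ContinuousLinearMap.opNorm_nonneg _
  have hne' : CharacterSpace.toAlgHom φ ≠ CharacterSpace.toAlgHom ψ := by
    intro h
    exact hne (CharacterSpace.ext fun f => (DFunLike.congr_fun h f).symm)
  -- With this `δ`, the lower bound `2 - 5δ` equals `1 + D / 2`, which exceeds `D` because `D < 2`.
  obtain ⟨G, hG1, hG⟩ := exists_two_sub_le_norm_sub hA hd hne' (δ := (2 - D) / 10)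
    (by linarith) (by linarith)
  have hDG : ‖φ G - ψ G‖ ≤ D := by
    refine ((CharacterSpace.toCLM φ - CharacterSpace.toCLM ψ).le_opNorm G).trans ?_
    exact mul_le_of_le_one_right (norm_nonneg _) hG1
  have hG' : 2 - 5 * ((2 - D) / 10) ≤ ‖φ G - ψ G‖ := hG
  linarith

end UniformAlgebra

/-! ### Dense polynomials and iterated exponentials -/

/-- Separability gives a countable dense family of polynomials not vanishing at `x₀`; a polynomial
that vanishes there is first shifted by a small constant. -/
theorem exists_seq_dense_nonvanishing {N : ℕ} {K : Set (Fin N → ℂ)} (hK : IsCompact K)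
    (x₀ : Fin N → ℂ) : ∃ p : ℕ → MvPolynomial (Fin N) ℂ,
      (∀ n, MvPolynomial.eval x₀ (p n) ≠ 0) ∧
      ∀ q : MvPolynomial (Fin N) ℂ, ∀ ε > 0, ∃ n, ∀ z ∈ K,
        ‖MvPolynomial.eval z q - MvPolynomial.eval z (p n)‖ < ε := by
  set K' : Compacts (Fin N → ℂ) := ⟨K, hK⟩
  set S : Set C(K', ℂ) := polyOn K' '' {p | MvPolynomial.eval x₀ p ≠ 0} with hS
  obtain ⟨D, hDS, hDc, hSD⟩ := (IsSeparable.of_separableSpace S).exists_countable_dense_subset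
  have hSne : S.Nonempty := ⟨polyOn K' 1, 1, by simp, rfl⟩
  have hDne : D.Nonempty := by
    rw [Set.nonempty_iff_ne_empty]
    rintro rfl
    rw [closure_empty] at hSD
    exact Set.not_nonempty_empty (hSne.mono hSD)
  obtain ⟨d, rfl⟩ := hDc.exists_eq_range hDne
  choose p hp hpd using fun n => hDS (Set.mem_range_self n)
  refine ⟨p, hp, fun q ε hε => ?_⟩
  obtain ⟨q', hq', hqq'⟩ : ∃ q' : MvPolynomial (Fin N) ℂ, MvPolynomial.eval x₀ q' ≠ 0 ∧
      ∀ z, ‖MvPolynomial.eval z q - MvPolynomial.eval z q'‖ ≤ ε / 2 := by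
    by_cases h : MvPolynomial.eval x₀ q = 0
    · refine ⟨q + MvPolynomial.C ((ε / 2 : ℝ) : ℂ), ?_, fun z => ?_⟩
      · rw [map_add, h, MvPolynomial.eval_C, zero_add]
        exact_mod_cast (half_pos hε).ne'
      · rw [map_add, MvPolynomial.eval_C, sub_add_cancel_left, norm_neg, Complex.norm_real,
          Real.norm_of_nonneg (half_pos hε).le]
    · exact ⟨q, h, fun z => by rw [sub_self, norm_zero]; exact (half_pos hε).le⟩
  obtain ⟨_, ⟨n, rfl⟩, hn⟩ := Metric.mem_closure_iff.1 (hSD ⟨q', hq', rfl⟩) (ε / 2) (half_pos hε)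
  refine ⟨n, fun z hz => ?_⟩
  have h1 : ‖MvPolynomial.eval z q' - MvPolynomial.eval z (p n)‖ < ε / 2 := by
    rw [← hpd n, dist_eq_norm] at hn
    exact (ContinuousMap.norm_coe_le_norm (polyOn K' q' - polyOn K' (p n)) ⟨z, hz⟩).trans_lt hn
  calc ‖MvPolynomial.eval z q - MvPolynomial.eval z (p n)‖
      ≤ ‖MvPolynomial.eval z q - MvPolynomial.eval z q'‖ +
        ‖MvPolynomial.eval z q' - MvPolynomial.eval z (p n)‖ := norm_sub_le_norm_sub_add_norm_sub _ _ _
    _ < ε := by linarith [hqq' z]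

/-- Iterated exponentials `fₙ₊₁ = Pₙ exp (Mₙ fₙ) - 1` with `f₀ = 0`. -/
noncomputable def iteratedExp {E : Type*} (P : ℕ → E → ℂ) (M : ℕ → ℝ) : ℕ → E → ℂ
  | 0 => fun _ => 0
  | n + 1 => fun z => P n z * Complex.exp (M n * iteratedExp P M n z) - 1

theorem iteratedExp_succ {E : Type*} (P : ℕ → E → ℂ) (M : ℕ → ℝ) (n : ℕ) (z : E) :
    iteratedExp P M (n + 1) z = P n z * Complex.exp (M n * iteratedExp P M n z) - 1 := rfl

theorem contDiff_iteratedExp {E : Type*} [NormedAddCommGroup E] [NormedSpace ℂ E]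
    {P : ℕ → E → ℂ} {k : WithTop ℕ∞} (hP : ∀ n, ContDiff ℂ k (P n)) (M : ℕ → ℝ) (n : ℕ) :
    ContDiff ℂ k (iteratedExp P M n) := by
  induction n with
  | zero => exact contDiff_const
  | succ n ih => exact ((hP n).mul (contDiff_const.mul ih).cexp).sub contDiff_const

theorem iteratedExp_eq_zero {E : Type*} {P : ℕ → E → ℂ} (M : ℕ → ℝ) {x : E}
    (hx : ∀ n, P n x = 1) (n : ℕ) : iteratedExp P M n x = 0 := by
  induction n with
  | zero => rfl
  | succ n ih => simp [iteratedExp_succ, ih, hx]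

/-- With the factor `4 C`, a real part below `-1/2` gives a product of modulus at most `C exp(-2C)`,
which is below `1/2` since `exp(2C) > 2C`. -/
theorem neg_half_le_re_iteratedExp_of_succ {E : Type*} {P : ℕ → E → ℂ} {C : ℕ → ℝ}
    (hC : ∀ n, 0 < C n) {n : ℕ} {z : E} (hz : ‖P n z‖ ≤ C n)
    (h : -(1 / 2) ≤ (iteratedExp P (fun n => 4 * C n) (n + 1) z).re) :
    -(1 / 2) ≤ (iteratedExp P (fun n => 4 * C n) n z).re := by
  by_contra! hlt
  have hCn := (hC n).le
  set w := iteratedExp P (fun n => 4 * C n) n z with hw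
  rw [iteratedExp_succ, Complex.sub_re, Complex.one_re] at h
  have h1 := Complex.re_le_norm (P n z * Complex.exp ((4 * C n : ℝ) * w))
  rw [norm_mul, Complex.norm_exp, Complex.re_ofReal_mul] at h1
  have h2 : Real.exp (4 * C n * w.re) ≤ Real.exp (-(2 * C n)) :=
    Real.exp_le_exp.2 (by nlinarith [hC n])
  have h3 : ‖P n z‖ * Real.exp (4 * C n * w.re) ≤ C n * Real.exp (-(2 * C n)) := by gcongr
  have h4 : C n * Real.exp (-(2 * C n)) < 1 / 2 := by
    rw [Real.exp_neg, ← div_eq_mul_inv, div_lt_iff₀ (Real.exp_pos _)]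
    linarith [Real.add_one_le_exp (2 * C n)]
  linarith

/-! ### Dense exponentials in `P(X)` and the construction of `X` -/

theorem isClosed_polyAlg {N : ℕ} (X : Compacts (Fin N → ℂ)) :
    IsClosed (polyAlg X : Set C(X, ℂ)) :=
  (polyOn X).range.isClosed_topologicalClosure

theorem polyOn_mem_polyAlg {N : ℕ} (X : Compacts (Fin N → ℂ)) (p : MvPolynomial (Fin N) ℂ) :
    polyOn X p ∈ polyAlg X := (polyAlg.ofPoly X p).2

theorem exists_mem_polyAlg_eq_iteratedExp {N : ℕ} (X : Compacts (Fin N → ℂ))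
    {P : ℕ → (Fin N → ℂ) → ℂ} (hP : ∀ n, ∃ a ∈ polyAlg X, ∀ x : X, a x = P n x) (M : ℕ → ℝ)
    (n : ℕ) : ∃ a ∈ polyAlg X, ∀ x : X, a x = iteratedExp P M n x := by
  induction n with
  | zero => exact ⟨0, (polyAlg X).zero_mem, fun x => rfl⟩
  | succ n ih =>
    obtain ⟨a, ha, hax⟩ := ih
    obtain ⟨b, hb, hbx⟩ := hP n
    obtain ⟨e, he, hex⟩ := exists_mem_exp (isClosed_polyAlg X)
      ((polyAlg X).smul_mem ha ((M n : ℝ) : ℂ))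
    refine ⟨b * e - 1, (polyAlg X).sub_mem ((polyAlg X).mul_mem hb he) (polyAlg X).one_mem,
      fun x => ?_⟩
    simp [iteratedExp_succ, hex, hax, hbx]

theorem exists_mem_polyAlg_exp_eq {N : ℕ} (X : Compacts (Fin N → ℂ)) {P : ℕ → (Fin N → ℂ) → ℂ}
    (hP : ∀ n, ∃ a ∈ polyAlg X, ∀ x : X, a x = P n x) (M : ℕ → ℝ) {n : ℕ}
    (h : ∀ x : X, -(1 / 2) ≤ (iteratedExp P M (n + 1) x).re) :
    ∃ g ∈ polyAlg X, ∀ x : X, Complex.exp (g x) = P n x := by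
  obtain ⟨a, ha, hax⟩ := exists_mem_polyAlg_eq_iteratedExp X hP M n
  obtain ⟨b, hb, hbx⟩ := exists_mem_polyAlg_eq_iteratedExp X hP M (n + 1)
  obtain ⟨g, hg, hgx⟩ := exists_mem_exp_eq_of_re (isClosed_polyAlg X)
    ((polyAlg X).add_mem (polyAlg X).one_mem hb) (ε := 1 / 2) (by norm_num) (fun x => by
      have := h x
      rw [ContinuousMap.add_apply, hbx, Complex.add_re, ContinuousMap.one_apply, Complex.one_re]
      linarith)
  refine ⟨g - ((M n : ℝ) : ℂ) • a, (polyAlg X).sub_mem hg ((polyAlg X).smul_mem ha _),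
    fun x => ?_⟩
  have h1 : Complex.exp (g x) = P n x * Complex.exp (M n * a x) := by
    rw [hgx, ContinuousMap.add_apply, ContinuousMap.one_apply, hbx, iteratedExp_succ, hax]
    ring
  rw [ContinuousMap.sub_apply, Complex.exp_sub, h1]
  exact mul_div_cancel_right₀ _ (Complex.exp_ne_zero _)

theorem hasDenseInvertibles_of_dense_exp {X : Type*} [TopologicalSpace X] [CompactSpace X]
    {A : Subalgebra ℂ C(X, ℂ)} (hA : IsClosed (A : Set C(X, ℂ)))
    (hd : ∀ f : A, ∀ ε > 0, ∃ u g : A, ‖f - u‖ < ε ∧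
      ∀ x, (u : C(X, ℂ)) x = Complex.exp ((g : C(X, ℂ)) x)) : HasDenseInvertibles A := by
  refine Metric.dense_iff.2 fun f ε hε => ?_
  obtain ⟨u, g, hu, hug⟩ := hd f ε hε
  obtain ⟨v, hv, hvx⟩ := exists_mem_exp hA (A.neg_mem g.2)
  refine ⟨u, by rwa [mem_ball_iff_norm'], IsUnit.of_mul_eq_one ⟨v, hv⟩ ?_⟩
  ext x
  change (u : C(X, ℂ)) x * v x = 1
  rw [hug, hvx, ContinuousMap.neg_apply, ← Complex.exp_add, add_neg_cancel, Complex.exp_zero]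

theorem exists_exp_near_polyAlg {N : ℕ} {X : Compacts (Fin N → ℂ)}
    (h : ∀ q : MvPolynomial (Fin N) ℂ, ∀ ε > 0, ∃ p : MvPolynomial (Fin N) ℂ,
      (∀ x : X, ‖MvPolynomial.eval (x : Fin N → ℂ) q - MvPolynomial.eval (x : Fin N → ℂ) p‖ < ε) ∧
      ∃ g ∈ polyAlg X, ∀ x : X, Complex.exp (g x) = MvPolynomial.eval (x : Fin N → ℂ) p)
    (f : polyAlg X) {ε : ℝ} (hε : 0 < ε) : ∃ u g : polyAlg X, ‖f - u‖ < ε ∧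
      ∀ x, (u : C(X, ℂ)) x = Complex.exp ((g : C(X, ℂ)) x) := by
  obtain ⟨q, hq⟩ := Metric.denseRange_iff.1 (polyAlg.denseRange_ofPoly X) f (ε / 2) (half_pos hε)
  obtain ⟨p, hqp, g, hg, hgx⟩ := h q (ε / 2) (half_pos hε)
  refine ⟨polyAlg.ofPoly X p, ⟨g, hg⟩, ?_, fun x => (hgx x).symm⟩
  have h1 : ‖polyAlg.ofPoly X q - polyAlg.ofPoly X p‖ ≤ ε / 2 :=
    (ContinuousMap.norm_le _ (half_pos hε).le).2 fun x => (hqp x).le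
  have h2 : ‖f - polyAlg.ofPoly X q‖ < ε / 2 := by rw [← dist_eq_norm]; exact hq
  linarith [norm_sub_le_norm_sub_add_norm_sub f (polyAlg.ofPoly X q) (polyAlg.ofPoly X p)]

theorem corollary1p3 (N : ℕ) (hN : 2 ≤ N) (Ω : Set (Fin N → ℂ)) (hΩ : IsOpen Ω)
    (hb : Bornology.IsBounded Ω) (x₀ : Fin N → ℂ) (hx₀ : x₀ ∈ Ω) :
    ∃ X : Compacts (Fin N → ℂ), (X : Set (Fin N → ℂ)) ⊆ frontier Ω ∧
      ∃ hx : x₀ ∈ polynomialHull X, x₀ ∉ X ∧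
        IsOnePointGleasonPart (polyAlg.evalAt X x₀ hx) ∧
        HasDenseInvertibles (polyAlg X) := by
  have hK : IsCompact (closure Ω) := hb.isCompact_closure
  have hfK : frontier Ω ⊆ closure Ω := frontier_subset_closure
  have hfc : IsCompact (frontier Ω) := hK.of_isClosed_subset isClosed_frontier hfK
  obtain ⟨p, hp0, hpd⟩ := exists_seq_dense_nonvanishing hK x₀
  set P : ℕ → (Fin N → ℂ) → ℂ := fun n z =>
    (MvPolynomial.eval x₀ (p n))⁻¹ * MvPolynomial.eval z (p n) with hP
  have hPd : ∀ n, ContDiff ℂ 2 (P n) := fun n =>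
    contDiff_const.mul (contDiff_eval_mvPolynomial (p n))
  have hP1 : ∀ n, P n x₀ = 1 := fun n => inv_mul_cancel₀ (hp0 n)
  have hbound : ∀ n, ∃ C : ℝ, 0 < C ∧ ∀ z ∈ closure Ω, ‖P n z‖ ≤ C := fun n => by
    obtain ⟨C, hC⟩ := hK.exists_bound_of_continuousOn (hPd n).continuous.continuousOn
    exact ⟨max C 1, by positivity, fun z hz => (hC z hz).trans (le_max_left _ _)⟩
  choose C hC0 hC using hbound
  set F := iteratedExp P (fun n => 4 * C n) with hF
  have hFd : ∀ n, ContDiff ℂ 2 (F n) := contDiff_iteratedExp hPd _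
  set T : ℕ → Set (Fin N → ℂ) := fun n => frontier Ω ∩ {z | -(1 / 2) ≤ (F n z).re} with hT
  have hTc : ∀ n, IsClosed (T n) := fun n => isClosed_frontier.inter
    (isClosed_le continuous_const (Complex.continuous_re.comp (hFd n).continuous))
  have hTs : ∀ n, T (n + 1) ⊆ T n := fun n z hz =>
    ⟨hz.1, neg_half_le_re_iteratedExp_of_succ hC0 (hC n z (hfK hz.1)) hz.2⟩
  set X : Compacts (Fin N → ℂ) := ⟨⋂ n, T n, hfc.of_isClosed_subset (isClosed_iInter hTc)
    ((Set.iInter_subset T 0).trans Set.inter_subset_left)⟩ with hX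
  have hXT : ∀ x : X, ∀ n, (x : Fin N → ℂ) ∈ T n := fun x n => Set.mem_iInter.1 x.2 n
  have hXf : (X : Set (Fin N → ℂ)) ⊆ frontier Ω := fun x hx => (hXT ⟨x, hx⟩ 0).1
  have hPX : ∀ n, ∃ a ∈ polyAlg X, ∀ x : X, a x = P n x := fun n =>
    ⟨(MvPolynomial.eval x₀ (p n))⁻¹ • polyOn X (p n),
      (polyAlg X).smul_mem (polyOn_mem_polyAlg X _) _, fun x => rfl⟩
  have hd : ∀ f : polyAlg X, ∀ ε > 0, ∃ u g : polyAlg X, ‖f - u‖ < ε ∧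
      ∀ x, (u : C(X, ℂ)) x = Complex.exp ((g : C(X, ℂ)) x) := by
    refine fun f ε hε => exists_exp_near_polyAlg (fun q ε hε => ?_) f hε
    obtain ⟨n, hn⟩ := hpd q ε hε
    refine ⟨p n, fun x => hn x (hfK (hXf x.2)), ?_⟩
    obtain ⟨g, hg, hgx⟩ := exists_mem_polyAlg_exp_eq X hPX (fun n => 4 * C n) (n := n)
      (fun x => (hXT x (n + 1)).2)
    -- The added constant undoes the normalization `Pₙ(x₀) = 1`.
    refine ⟨g + algebraMap ℂ _ (Complex.log (MvPolynomial.eval x₀ (p n))),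
      (polyAlg X).add_mem hg ((polyAlg X).algebraMap_mem _), fun x => ?_⟩
    change Complex.exp (g x + Complex.log (MvPolynomial.eval x₀ (p n))) = _
    rw [Complex.exp_add, hgx, Complex.exp_log (hp0 n), mul_comm]
    exact mul_inv_cancel_left₀ (hp0 n) _
  have hx : x₀ ∈ polynomialHull X := by
    intro q
    have hqd : ContDiff ℂ 2 fun z : Fin N → ℂ => MvPolynomial.eval z q :=
      contDiff_eval_mvPolynomial q
    have hcl : ∀ n, IsClosed (T n ∩ {z | ‖MvPolynomial.eval x₀ q‖ ≤ ‖MvPolynomial.eval z q‖}) :=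
      fun n => (hTc n).inter (isClosed_le continuous_const hqd.continuous.norm)
    obtain ⟨b, hb⟩ := IsCompact.nonempty_iInter_of_sequence_nonempty_isCompact_isClosed
      (fun n => T n ∩ {z | ‖MvPolynomial.eval x₀ q‖ ≤ ‖MvPolynomial.eval z q‖})
      (fun n => Set.inter_subset_inter_left _ (hTs n))
      (fun n => by
        obtain ⟨b, hbf, hfb, hqb⟩ := exists_mem_frontier_zero_norm_le_pi hN (hFd n) hqd hΩ hb hx₀
          (iteratedExp_eq_zero _ hP1 n)
        -- A boundary zero of `Fₙ` lies in `T n` because `0 ≥ -1/2`.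
        exact ⟨b, ⟨hbf, by simp [hfb]⟩, hqb⟩)
      (hfc.of_isClosed_subset (hcl 0) fun z hz => hz.1.1) hcl
    have hb' := Set.mem_iInter.1 hb
    have hbX : b ∈ X := Set.mem_iInter.2 fun n => (hb' n).1
    exact (hb' 0).2.trans (ContinuousMap.norm_coe_le_norm (polyOn X q) ⟨b, hbX⟩)
  refine ⟨X, hXf, hx, fun h => ?_, isOnePointGleasonPart_of_dense_exp (isClosed_polyAlg X) hd _,
    hasDenseInvertibles_of_dense_exp (isClosed_polyAlg X) hd⟩
  have := (hXf h).2
  rw [hΩ.interior_eq] at this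
  exact this hx₀
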